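/- Theorem 1 (sufficient condition). For a matrix $\bar A\in\mathbb R^{M\times N}$, a random matrix $E\in\mathbb R^{M\times N}$ with $\mathbb E\|E\|_2^2<\infty$ (where $\|\cdot\|_2$ is the spectral norm), $P=\mathbb E(E^TE)$, $\lambda_2\ge 0$ and $y\in\mathbb R^M$ consider the robust $\ell_0$ problem $$\text{(RL0)}\qquad \min_\theta\ \|\theta\|_0+\lambda_2\sqrt{\theta^TP\theta}\quad\text{s.t. } y=\bar A\theta$$ and its convex relaxation $$\text{(CR-L1)}\qquad \min_\theta\ \|\theta\|_1+\lambda_2\sqrt{\theta^TP\theta}\quad\text{s.t. } y=\bar A\theta .$$ There are absolute constants $C_1>0$ and $c>0$ such that for all $M,N$, if the entries of $\bar A$ are i.i.d. standard Gaussian, then outside an event of probability at most $e^{-cM}$ the following holds simultaneously for every law of $E$ with $\mathbb E\|E\|_2^2<\infty$, every $K\in\mathbb N$ and every $\lambda_2\ge0$. (i) If $$M\ \ge\ \frac{\bigl(2\sqrt K+\lambda_2C_2\bigr)^2}{C_1^2}\,\log N,\qquad C_2=\bigl(\mathbb E\|E\|_2^2\bigr)^{1/2},$$ then for every $y$, every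 optimal solution $\alpha$ of (RL0) with $\|\alpha\|_0\le K$ is the unique optimal solution of (CR-L1). (ii) If $\kappa\ge1$ satisfies $(\mathbb E\|E\|_2^2)^{1/2}\le\kappa\,\mathbb E\|E\|_2$ (for instance $\kappa=1$ when $E$ is deterministic), then the same conclusion holds under the condition with $C_2=\mathbb E\|E\|_2$ and $C_1$ replaced by $C_1/\kappa$: $$M\ \ge\ \frac{\bigl(2\sqrt K+\lambda_2\,\mathbb E\|E\|_2\bigr)^2}{(C_1/\kappa)^2}\,\log N .$$ -/

import Mathlib

open MeasureTheory ProbabilityTheory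

noncomputable section

/-- The `ℓ₁` norm `∑ₙ |θₙ|` of a real vector. -/
def ellOne {N : ℕ} (θ : Fin N → ℝ) : ℝ := ∑ n, |θ n|

open scoped Matrix.Norms.L2Operator in
/-- The spectral norm of a real matrix: the operator norm from Euclidean `ℝᴺ` to Euclidean `ℝᴹ`. -/
def specNorm {M N : ℕ} (E : Matrix (Fin M) (Fin N) ℝ) : ℝ := ‖E‖

/-- The entrywise (product, equivalently Borel) measurable structure on real matrices. -/
instance matrixMeasurableSpace {M N : ℕ} : MeasurableSpace (Matrix (Fin M) (Fin N) ℝ) :=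
  inferInstanceAs (MeasurableSpace (Fin M → Fin N → ℝ))

/-- The matrix `P = 𝔼(EᵀE)` of a random matrix `E` with law `ν`. -/
def errorCov {M N : ℕ} (ν : Measure (Matrix (Fin M) (Fin N) ℝ)) : Matrix (Fin N) (Fin N) ℝ :=
  Matrix.of fun i j => ∫ E, (E.transpose * E) i j ∂ν

/-- The random matrix `E` with law `ν` has a finite second moment, `𝔼‖E‖₂² < ∞`. -/
def FiniteSecondMoment {M N : ℕ} (ν : Measure (Matrix (Fin M) (Fin N) ℝ)) : Prop :=
  Integrable (fun E => specNorm E ^ 2) ν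

/-- The expectation `𝔼‖E‖₂`, for `E` with law `ν`. -/
def meanNorm {M N : ℕ} (ν : Measure (Matrix (Fin M) (Fin N) ℝ)) : ℝ := ∫ E, specNorm E ∂ν

/-- The root mean square `(𝔼‖E‖₂²)^{1/2}`, for `E` with law `ν`. -/
def rmsNorm {M N : ℕ} (ν : Measure (Matrix (Fin M) (Fin N) ℝ)) : ℝ :=
  Real.sqrt (∫ E, specNorm E ^ 2 ∂ν)

/-- The feasible set `{θ : Ā θ = y}`. -/
def feasible {M N : ℕ} (Abar : Matrix (Fin M) (Fin N) ℝ) (y : Fin M → ℝ) : Set (Fin N → ℝ) :=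
  {θ | Abar.mulVec θ = y}

/-- The penalty `√(θᵀ P θ)`. -/
def penalty {N : ℕ} (P : Matrix (Fin N) (Fin N) ℝ) (θ : Fin N → ℝ) : ℝ :=
  Real.sqrt (θ ⬝ᵥ P.mulVec θ)

/-- The set of optimal solutions of the robust `ℓ₀` problem
`min ‖θ‖₀ + lam √(θᵀPθ)` subject to `y = Ā θ`
(`hammingNorm θ` is the number of nonzero entries of `θ`). -/
def solRL0 {M N : ℕ} (Abar : Matrix (Fin M) (Fin N) ℝ) (P : Matrix (Fin N) (Fin N) ℝ) (lam : ℝ)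
    (y : Fin M → ℝ) : Set (Fin N → ℝ) :=
  {α | α ∈ feasible Abar y ∧
    IsMinOn (fun θ => (hammingNorm θ : ℝ) + lam * penalty P θ) (feasible Abar y) α}

/-- The set of optimal solutions of the convex relaxation
`min ‖θ‖₁ + lam √(θᵀPθ)` subject to `y = Ā θ`. -/
def solCRL1 {M N : ℕ} (Abar : Matrix (Fin M) (Fin N) ℝ) (P : Matrix (Fin N) (Fin N) ℝ) (lam : ℝ)
    (y : Fin M → ℝ) : Set (Fin N → ℝ) :=
  {β | β ∈ feasible Abar y ∧
    IsMinOn (fun θ => ellOne θ + lam * penalty P θ) (feasible Abar y) β}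

/-- The convex relaxation solves the robust `ℓ₀` problem at sparsity `K`: for every measurement
vector `y`, every optimal solution `α` of the robust `ℓ₀` problem with at most `K` nonzero entries
is the one and only optimal solution of the convex relaxation. -/
def RelaxationSolves {M N : ℕ} (Abar : Matrix (Fin M) (Fin N) ℝ)
    (P : Matrix (Fin N) (Fin N) ℝ) (lam : ℝ) (K : ℕ) : Prop :=
  ∀ y : Fin M → ℝ, ∀ α ∈ solRL0 Abar P lam y, hammingNorm α ≤ K → solCRL1 Abar P lam y = {α}

/-- The random matrix `A` on `(Ω, μ)` has i.i.d. standard Gaussian entries. -/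
def IsStdGaussianMatrix {Ω : Type*} [MeasurableSpace Ω] {M N : ℕ}
    (A : Ω → Matrix (Fin M) (Fin N) ℝ) (μ : Measure Ω) : Prop :=
  (∀ i j, HasLaw (fun ω => A ω i j) (gaussianReal 0 1) μ) ∧
    iIndepFun (fun (p : Fin M × Fin N) ω => A ω p.1 p.2) μ

end

/-!
Outside an exponentially unlikely event every nonzero `h` in the kernel of the Gaussian matrix
satisfies `‖h‖₁ √(log N) > √M ‖h‖₂ / 72`. Such a kernel forces the recovery: if `α` is `K`-sparse
and `θ = α + h` is another feasible point, then `‖θ‖₁ - ‖α‖₁ ≥ ‖h‖₁ - 2√K ‖h‖₂`, while the penalty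
is the seminorm `√(𝔼‖Eθ‖²)`, so that it drops by at most `(𝔼‖E‖²)^{1/2} ‖h‖₂`. Under the condition
on `M` the gain exceeds the loss (`relaxationSolves_of_kernel`). The second part of the theorem
follows from the first, since `2√K + λ(𝔼‖E‖²)^{1/2} ≤ κ(2√K + λ𝔼‖E‖)`. Of the optimality of `α`
for the `ℓ₀` problem, only feasibility and sparsity matter.

The kernel bound comes from Maurey's empirical method, run in the Hilbert norm
`x ↦ (‖Ax‖² + D‖x‖²)^{1/2}`, where `D = 8M` bounds all squared column norms. If `‖h‖₁ = 1` and
`Ah = 0`, then some sum `w` of `m` signed coordinate vectors satisfies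
`‖Aw‖² + D‖w - mh‖² ≤ 2Dm` (`exists_signedSum_approx`). When `‖h‖₂` is large compared with
`m^{-1/2}`, this makes `‖Aw‖²` much smaller than its expected value `M‖w‖²`. For a fixed `w` a
Chernoff bound makes this exponentially unlikely in `M`, and there are only `(2N)^m` words `w`, with
`m log N` a small multiple of `M`. Measuring the approximation error through `A` as well as in the
Euclidean norm is what removes the need for any operator norm bound on sparse vectors.
-/

/-! ### Maurey's empirical method -/

/-- One step of the derandomized empirical method. If `u = ∑ hᵢ vᵢ` with `∑ |hᵢ| = 1`, then `u` is
the mean of a random signed atom `± vᵢ` drawn with probability `|hᵢ|`, so the cross term vanishes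
on average and some atom `a` satisfies `‖z + a - u‖² ≤ ‖z‖² + B`. -/
theorem exists_signed_step {H ι : Type*} [NormedAddCommGroup H] [InnerProductSpace ℝ H] [Fintype ι]
    (v : ι → H) (h : ι → ℝ) (hh : ∑ i, |h i| = 1) {B : ℝ} (hv : ∀ i, ‖v i‖ ^ 2 ≤ B) (z : H) :
    ∃ p : ι × ℤˣ, ‖z + ((p.2 : ℤ) : ℝ) • v p.1 - ∑ i, h i • v i‖ ^ 2 ≤ ‖z‖ ^ 2 + B := by
  by_contra! hcon
  set u := ∑ i, h i • v i with hu
  have hsign : ∀ i, ∃ σ : ℤˣ, |h i| * ((σ : ℤ) : ℝ) = h i := by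
    intro i
    rcases le_total 0 (h i) with hi | hi
    · exact ⟨1, by simp [abs_of_nonneg hi]⟩
    · exact ⟨-1, by simp [abs_of_nonpos hi]⟩
  choose σ hσ using hsign
  have hexp : ∀ i, |h i| * ‖z + ((σ i : ℤ) : ℝ) • v i - u‖ ^ 2
      ≤ |h i| * (‖z - u‖ ^ 2 + B) + 2 * inner ℝ (z - u) (h i • v i) := by
    intro i
    have h1 : z + ((σ i : ℤ) : ℝ) • v i - u = (z - u) + ((σ i : ℤ) : ℝ) • v i := by abel
    have h2 : ‖((σ i : ℤ) : ℝ) • v i‖ ^ 2 ≤ B := by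
      rcases Int.units_eq_one_or (σ i) with h | h <;> simpa [h] using hv i
    have h3 : inner ℝ (z - u) (h i • v i)
        = |h i| * inner ℝ (z - u) (((σ i : ℤ) : ℝ) • v i) := by
      rw [← real_inner_smul_right, smul_smul, hσ]
    rw [h1, norm_add_sq_real, h3]
    nlinarith [mul_le_mul_of_nonneg_left h2 (abs_nonneg (h i))]
  have hlt : ‖z‖ ^ 2 + B < ∑ i, |h i| * ‖z + ((σ i : ℤ) : ℝ) • v i - u‖ ^ 2 := by
    calc ‖z‖ ^ 2 + B = ∑ i, |h i| * (‖z‖ ^ 2 + B) := by rw [← Finset.sum_mul, hh, one_mul]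
      _ < _ := by
        refine Finset.sum_lt_sum
          (fun i _ => mul_le_mul_of_nonneg_left (hcon (i, σ i)).le (abs_nonneg _)) ?_
        obtain ⟨i, -, hi⟩ : ∃ i ∈ Finset.univ, 0 < |h i| := by
          refine Finset.exists_lt_of_sum_lt (by simp [hh])
        exact ⟨i, Finset.mem_univ _, mul_lt_mul_of_pos_left (hcon (i, σ i)) hi⟩
  have hle := Finset.sum_le_sum fun i (_ : i ∈ Finset.univ) => hexp i
  rw [Finset.sum_add_distrib, ← Finset.sum_mul, hh, ← Finset.mul_sum, ← inner_sum, ← hu] at hle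
  have h4 := norm_sub_sq_real z u
  have h5 : inner ℝ (z - u) u = inner ℝ z u - ‖u‖ ^ 2 := by
    rw [inner_sub_left, real_inner_self_eq_norm_sq]
  nlinarith [sq_nonneg ‖u‖]

/-- Maurey's lemma: a point `u` of the absolutely convex hull of vectors of squared norm at most `B`
is approximated by an average of `m` signed atoms with squared error at most `B / m`
(stated here after multiplication by `m²`). -/
theorem exists_signed_sum_approx {H ι : Type*} [NormedAddCommGroup H] [InnerProductSpace ℝ H]
    [Fintype ι] (v : ι → H) (h : ι → ℝ) (hh : ∑ i, |h i| = 1) {B : ℝ}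
    (hv : ∀ i, ‖v i‖ ^ 2 ≤ B) (m : ℕ) :
    ∃ f : Fin m → ι × ℤˣ,
      ‖∑ k, (((f k).2 : ℤ) : ℝ) • v (f k).1 - (m : ℝ) • ∑ i, h i • v i‖ ^ 2 ≤ m * B := by
  induction m with
  | zero => exact ⟨Fin.elim0, by simp⟩
  | succ m ih =>
    obtain ⟨f, hf⟩ := ih
    obtain ⟨p, hp⟩ := exists_signed_step v h hh hv
      (∑ k, (((f k).2 : ℤ) : ℝ) • v (f k).1 - (m : ℝ) • ∑ i, h i • v i)
    refine ⟨Fin.snoc f p, ?_⟩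
    rw [Fin.sum_univ_castSucc]
    simp only [Fin.snoc_castSucc, Fin.snoc_last]
    push_cast
    have : ∑ k, (((f k).2 : ℤ) : ℝ) • v (f k).1 + ((p.2 : ℤ) : ℝ) • v p.1
          - ((m : ℝ) + 1) • ∑ i, h i • v i
        = ∑ k, (((f k).2 : ℤ) : ℝ) • v (f k).1 - (m : ℝ) • ∑ i, h i • v i
          + ((p.2 : ℤ) : ℝ) • v p.1 - ∑ i, h i • v i := by
      rw [add_smul, one_smul]; abel
    rw [this]
    linarith

/-- The integer vector `∑ₖ σₖ e_{iₖ}` attached to a word `k ↦ (iₖ, σₖ)` in the signed coordinate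
vectors `± eᵢ`. -/
noncomputable def signedSum {N m : ℕ} (f : Fin m → Fin N × ℤˣ) : Fin N → ℝ :=
  ∑ k, (((f k).2 : ℤ) : ℝ) • Pi.single (f k).1 1

/-- Maurey's lemma for a kernel vector in the Hilbert norm `(‖Ax‖² + D‖x‖²)^{1/2}`, in which every
coordinate vector has squared norm at most `2D`. -/
theorem exists_signedSum_approx {M N : ℕ} (A : Matrix (Fin M) (Fin N) ℝ) {D : ℝ} (hD : 0 ≤ D)
    (hA : ∀ j, ∑ i, A i j ^ 2 ≤ D) (h : Fin N → ℝ) (hh : ellOne h = 1) (hker : A.mulVec h = 0)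
    (m : ℕ) : ∃ f : Fin m → Fin N × ℤˣ,
      ∑ i, A.mulVec (signedSum f) i ^ 2 + D * ∑ j, (signedSum f j - m * h j) ^ 2
        ≤ m * (2 * D) := by
  let L : (Fin N → ℝ) →ₗ[ℝ] EuclideanSpace ℝ (Fin M ⊕ Fin N) :=
    { toFun := fun x => WithLp.toLp 2 (Sum.elim (A.mulVec x) (√D • x))
      map_add' := by
        intro x y; ext (i | j) <;> simp [Matrix.mulVec_add]
      map_smul' := by
        intro c x; ext (i | j) <;> simp [Matrix.mulVec_smul]; ring }
  have hL : ∀ x, ‖L x‖ ^ 2 = ∑ i, A.mulVec x i ^ 2 + D * ∑ j, x j ^ 2 := by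
    intro x
    simp [L, EuclideanSpace.real_norm_sq_eq, Fintype.sum_sum_type, mul_pow, Real.sq_sqrt hD,
      Finset.mul_sum]
  obtain ⟨f, hf⟩ := exists_signed_sum_approx (fun j => L (Pi.single j 1)) h hh (B := 2 * D)
    (fun j => by
      rw [hL]
      have : ∑ k, (Pi.single j 1 : Fin N → ℝ) k ^ 2 = 1 := by
        simp [Pi.single_apply]
      rw [this]
      simp only [Matrix.mulVec_single_one, Matrix.col_apply]
      linarith [hA j]) m
  refine ⟨f, ?_⟩
  have h1 : ∑ j, h j • (Pi.single j 1 : Fin N → ℝ) = h := by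
    ext k; simp [Finset.sum_apply, Pi.single_apply]
  simp only [← map_smul, ← map_sum, ← map_sub] at hf
  rw [h1, hL] at hf
  change ∑ i, A.mulVec (signedSum f - (m : ℝ) • h) i ^ 2
    + D * ∑ j, (signedSum f - (m : ℝ) • h) j ^ 2 ≤ _ at hf
  rw [Matrix.mulVec_sub, Matrix.mulVec_smul, hker, smul_zero, sub_zero] at hf
  simpa using hf

/-- A kernel vector with small ratio `‖h‖₁² / ‖h‖₂²` produces a nonzero signed sum `w` of `m`
coordinate vectors for which `‖Aw‖² / ‖w‖²` is small. -/
theorem exists_signedSum_mulVec_small {M N : ℕ} (A : Matrix (Fin M) (Fin N) ℝ) {D s : ℝ}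
    (hD : 0 < D) (hA : ∀ j, ∑ i, A i j ^ 2 ≤ D) (h : Fin N → ℝ) (hne : h ≠ 0)
    (hker : A.mulVec h = 0) (hs : ellOne h ^ 2 ≤ s * ∑ j, h j ^ 2) {m : ℕ} (hm0 : 0 < m)
    (hm : 324 * s ≤ m) :
    ∃ f : Fin m → Fin N × ℤˣ, 0 < ∑ j, signedSum f j ^ 2 ∧
      ∑ i, A.mulVec (signedSum f) i ^ 2 ≤ D / 128 * ∑ j, signedSum f j ^ 2 := by
  have hpos : 0 < ellOne h := by
    obtain ⟨j, hj⟩ := Function.ne_iff.mp hne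
    exact Finset.sum_pos' (fun _ _ => abs_nonneg _) ⟨j, Finset.mem_univ _, abs_pos.mpr hj⟩
  set g : Fin N → ℝ := (ellOne h)⁻¹ • h with hg
  have hg1 : ellOne g = 1 := by
    have : ellOne g = |(ellOne h)⁻¹| * ellOne h := by
      rw [hg, ellOne, ellOne, Finset.mul_sum]
      exact Finset.sum_congr rfl fun j _ => abs_mul _ _
    rw [this, abs_of_pos (inv_pos.mpr hpos), inv_mul_cancel₀ hpos.ne']
  have hgs : 1 ≤ s * ∑ j, g j ^ 2 := by
    have : ∑ j, g j ^ 2 = (∑ j, h j ^ 2) / ellOne h ^ 2 := by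
      simp only [hg, Pi.smul_apply, smul_eq_mul, mul_pow, ← Finset.mul_sum]
      field_simp
    rw [this, ← mul_div_assoc, one_le_div (by positivity)]
    exact hs
  obtain ⟨f, hf⟩ := exists_signedSum_approx A hD.le hA g hg1
    (by rw [hg, Matrix.mulVec_smul, hker, smul_zero]) m
  have hmR : (0 : ℝ) < m := by exact_mod_cast hm0
  set w := signedSum f
  have hAw : 0 ≤ ∑ i, A.mulVec w i ^ 2 := Finset.sum_nonneg fun _ _ => sq_nonneg _
  have hd : 0 ≤ ∑ j, (w j - m * g j) ^ 2 := Finset.sum_nonneg fun _ _ => sq_nonneg _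
  have hd2 : ∑ j, (w j - m * g j) ^ 2 ≤ 2 * m := by
    refine le_of_mul_le_mul_left ?_ hD
    linarith
  -- `‖m g‖ ≥ 18 √m` dominates the error `‖w - m g‖ ≤ √2 √m`, which gives `‖w‖ ≥ 16 √m`.
  have hg2 : 324 * m ≤ ∑ j, (m * g j) ^ 2 := by
    have hq : 0 ≤ ∑ j, g j ^ 2 := Finset.sum_nonneg fun _ _ => sq_nonneg _
    have h1 : (324 : ℝ) ≤ m * ∑ j, g j ^ 2 := by
      nlinarith [mul_le_mul_of_nonneg_right hm hq]
    simp only [mul_pow, ← Finset.mul_sum]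
    nlinarith
  have htri : ∑ j, (m * g j) ^ 2 ≤ 9 / 8 * ∑ j, w j ^ 2 + 9 * ∑ j, (w j - m * g j) ^ 2 := by
    rw [Finset.mul_sum, Finset.mul_sum, ← Finset.sum_add_distrib]
    refine Finset.sum_le_sum fun j _ => ?_
    nlinarith [sq_nonneg (w j + 8 * (w j - m * g j)), sq_nonneg (w j - 8 * (w j - m * g j))]
  have hw : 256 * m ≤ ∑ j, w j ^ 2 := by linarith
  refine ⟨f, by linarith, ?_⟩
  nlinarith [mul_nonneg hD.le hd, mul_le_mul_of_nonneg_left hw hD.le]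

/-! ### Squared norms of Gaussian vectors -/

theorem mgf_sq_of_hasLaw_gaussianReal {Ω : Type*} [MeasurableSpace Ω] {μ : Measure Ω} {X : Ω → ℝ}
    (hX : HasLaw X (gaussianReal 0 1) μ) {t : ℝ} (ht : t < 1 / 2) :
    mgf (fun ω => X ω ^ 2) μ t = (√(1 - 2 * t))⁻¹ := by
  have h1 : mgf (fun ω => X ω ^ 2) μ t = ∫ x, Real.exp (t * x ^ 2) ∂(gaussianReal 0 1) := by
    rw [← hX.map_eq, integral_map hX.aemeasurable (by fun_prop)]; rfl
  rw [h1, integral_gaussianReal_eq_integral_smul one_ne_zero]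
  have h2 : ∀ x : ℝ, gaussianPDFReal 0 1 x • Real.exp (t * x ^ 2)
      = (√(2 * Real.pi))⁻¹ * Real.exp (-(1 / 2 - t) * x ^ 2) := by
    intro x
    simp only [gaussianPDFReal, smul_eq_mul, NNReal.coe_one, mul_one, sub_zero, mul_assoc,
      ← Real.exp_add]
    ring_nf
  simp_rw [h2]
  rw [integral_const_mul, integral_gaussian, ← Real.sqrt_inv, ← Real.sqrt_inv,
    ← Real.sqrt_mul (by positivity)]
  congr 1
  have : 1 - 2 * t ≠ 0 := by linarith
  have : 1 / 2 - t ≠ 0 := by linarith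
  have := Real.pi_pos.ne'
  field_simp

theorem mgf_sum_sq_of_iIndepFun {Ω ι : Type*} [MeasurableSpace Ω] [Fintype ι] {μ : Measure Ω}
    {X : ι → Ω → ℝ} (hX : ∀ i, HasLaw (X i) (gaussianReal 0 1) μ) (hind : iIndepFun X μ)
    {t : ℝ} (ht : t < 1 / 2) :
    mgf (fun ω => ∑ i, X i ω ^ 2) μ t = (√(1 - 2 * t))⁻¹ ^ Fintype.card ι := by
  have h := (hind.comp (fun _ x => x ^ 2) (fun _ => by fun_prop)).mgf_sum₀ (t := t)
    (fun i => ((hX i).aemeasurable.pow_const 2)) Finset.univ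
  have h2 : (∑ i, (fun x : ℝ => x ^ 2) ∘ X i) = fun ω => ∑ i, X i ω ^ 2 := by
    ext ω; simp
  rw [h2] at h
  rw [h, ← Finset.card_univ, ← Finset.prod_const]
  exact Finset.prod_congr rfl fun i _ => mgf_sq_of_hasLaw_gaussianReal (hX i) ht

theorem integrable_exp_mul_sum_sq {Ω ι : Type*} [MeasurableSpace Ω] [Fintype ι] {μ : Measure Ω}
    {X : ι → Ω → ℝ} (hX : ∀ i, HasLaw (X i) (gaussianReal 0 1) μ) (hind : iIndepFun X μ)
    {t : ℝ} (ht : t < 1 / 2) :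
    Integrable (fun ω => Real.exp (t * ∑ i, X i ω ^ 2)) μ := by
  -- A Bochner integral that is not zero belongs to an integrable function.
  refine Integrable.of_integral_ne_zero ?_
  have h := mgf_sum_sq_of_iIndepFun hX hind ht
  rw [mgf] at h
  rw [h]
  have : 0 < √(1 - 2 * t) := Real.sqrt_pos.mpr (by linarith)
  positivity

/-- Upper Chernoff tail of a chi-squared variable, from the moment generating function
at `1 / 4`. -/
theorem measure_sum_sq_ge_le {Ω ι : Type*} [MeasurableSpace Ω] [Fintype ι] {μ : Measure Ω}
    {X : ι → Ω → ℝ} (hX : ∀ i, HasLaw (X i) (gaussianReal 0 1) μ) (hind : iIndepFun X μ) :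
    μ.real {ω | 8 * (Fintype.card ι : ℝ) ≤ ∑ i, X i ω ^ 2} ≤ Real.exp (-Fintype.card ι) := by
  have := hind.isProbabilityMeasure
  refine (measure_ge_le_exp_mul_mgf (t := 1 / 4) _ (by norm_num)
    (integrable_exp_mul_sum_sq hX hind (by norm_num))).trans ?_
  rw [mgf_sum_sq_of_iIndepFun hX hind (by norm_num)]
  have hb : (√(1 - 2 * (1 / 4 : ℝ)))⁻¹ ≤ Real.exp 1 := by
    rw [← Real.sqrt_inv, Real.sqrt_le_left (Real.exp_pos _).le]
    nlinarith [Real.add_one_le_exp (1 : ℝ)]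
  calc _ ≤ Real.exp (-(1 / 4) * (8 * Fintype.card ι)) * Real.exp 1 ^ Fintype.card ι := by gcongr
    _ = _ := by
      rw [← Real.exp_nat_mul, ← Real.exp_add]; ring_nf

/-- Lower Chernoff tail of a chi-squared variable, from the moment generating function
at `-4`. -/
theorem measure_sum_sq_le_le {Ω ι : Type*} [MeasurableSpace Ω] [Fintype ι] {μ : Measure Ω}
    {X : ι → Ω → ℝ} (hX : ∀ i, HasLaw (X i) (gaussianReal 0 1) μ) (hind : iIndepFun X μ) :
    μ.real {ω | ∑ i, X i ω ^ 2 ≤ (Fintype.card ι : ℝ) / 16}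
      ≤ Real.exp (-Fintype.card ι / 2) := by
  have := hind.isProbabilityMeasure
  refine (measure_le_le_exp_mul_mgf (t := -4) _ (by norm_num)
    (integrable_exp_mul_sum_sq hX hind (by norm_num))).trans ?_
  rw [mgf_sum_sq_of_iIndepFun hX hind (by norm_num)]
  have hb : (√(1 - 2 * (-4 : ℝ)))⁻¹ ≤ Real.exp (-3 / 4) := by
    rw [show (1 - 2 * (-4 : ℝ)) = 3 ^ 2 by norm_num, Real.sqrt_sq (by norm_num),
      show (-3 / 4 : ℝ) = -(3 / 4) by norm_num, Real.exp_neg]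
    refine inv_anti₀ (Real.exp_pos _) ?_
    have := Real.exp_one_lt_d9
    have : Real.exp (3 / 4) ≤ Real.exp 1 := Real.exp_le_exp.mpr (by norm_num)
    linarith
  calc _ ≤ Real.exp (-(-4) * (Fintype.card ι / 16)) * Real.exp (-3 / 4) ^ Fintype.card ι := by
        gcongr
    _ = _ := by
      rw [← Real.exp_nat_mul, ← Real.exp_add]; ring_nf

theorem covariance_mulVec {Ω : Type*} [MeasurableSpace Ω] {μ : Measure Ω} {M N : ℕ}
    {A : Ω → Matrix (Fin M) (Fin N) ℝ} (hA : IsStdGaussianMatrix A μ) (w : Fin N → ℝ)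
    (i k : Fin M) :
    cov[fun ω => (A ω).mulVec w i, fun ω => (A ω).mulVec w k; μ]
      = if i = k then ∑ j, w j ^ 2 else 0 := by
  have := hA.2.isProbabilityMeasure
  have hG : ∀ i j, HasGaussianLaw (fun ω => A ω i j) μ := fun i j => (hA.1 i j).hasGaussianLaw
  have hcov : ∀ j l, cov[fun ω => A ω i j, fun ω => A ω k l; μ]
      = if (i, j) = (k, l) then 1 else 0 := by
    intro j l
    split_ifs with h
    · obtain ⟨rfl, rfl⟩ := Prod.mk.inj h
      rw [covariance_self (hA.1 i j).aemeasurable, (hA.1 i j).variance_eq, variance_id_gaussianReal]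
      rfl
    · exact (hA.2.indepFun h).covariance_eq_zero (hG i j).memLp_two (hG k l).memLp_two
  simp only [Matrix.mulVec, dotProduct]
  rw [covariance_fun_sum_fun_sum (fun j => (hG i j).memLp_two.mul_const _)
    (fun j => (hG k j).memLp_two.mul_const _)]
  simp only [covariance_mul_const_left, covariance_mul_const_right, hcov]
  split_ifs with h
  · simp [h, pow_two]
  · simp [h]

/-- For a unit vector `w`, the vector `A w` is again standard Gaussian: its coordinates are jointly
Gaussian and uncorrelated. -/
theorem mulVec_gaussian {Ω : Type*} [MeasurableSpace Ω] {μ : Measure Ω} {M N : ℕ}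
    {A : Ω → Matrix (Fin M) (Fin N) ℝ} (hA : IsStdGaussianMatrix A μ) {w : Fin N → ℝ}
    (hw : ∑ j, w j ^ 2 = 1) :
    (∀ i, HasLaw (fun ω => (A ω).mulVec w i) (gaussianReal 0 1) μ) ∧
      iIndepFun (fun i ω => (A ω).mulVec w i) μ := by
  have hG := hA.2.hasGaussianLaw fun p : Fin M × Fin N => (hA.1 p.1 p.2).hasGaussianLaw
  let L : ((Fin M × Fin N) → ℝ) →L[ℝ] (Fin M → ℝ) :=
    ContinuousLinearMap.pi fun i => ∑ j, w j • ContinuousLinearMap.proj (i, j)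
  have hL : HasGaussianLaw (fun ω i => (A ω).mulVec w i) μ := by
    have h : (fun ω i => (A ω).mulVec w i) = fun ω => L fun p => A ω p.1 p.2 := by
      ext ω i
      simp [L, Matrix.mulVec, dotProduct, mul_comm]
    rw [h]
    exact hG.map_fun L
  refine ⟨fun i => ⟨(hL.eval i).aemeasurable, ?_⟩,
    hL.iIndepFun_of_covariance_eq_zero fun i k hik => by rw [covariance_mulVec hA, if_neg hik]⟩
  rw [(hL.eval i).map_eq_gaussianReal, ← covariance_self (hL.eval i).aemeasurable,
    covariance_mulVec hA, if_pos rfl, hw, Real.toNNReal_one]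
  congr 1
  simp only [Matrix.mulVec, dotProduct]
  rw [integral_finsetSum _ fun j _ => ((hA.1 i j).hasGaussianLaw.integrable.mul_const _)]
  refine Finset.sum_eq_zero fun j _ => ?_
  rw [integral_mul_const, (hA.1 i j).integral_eq, integral_id_gaussianReal, zero_mul]

/-! ### The robust penalty and the kernel criterion -/

open scoped Matrix.Norms.L2Operator in
theorem sum_mulVec_sq_le {M N : ℕ} (E : Matrix (Fin M) (Fin N) ℝ) (x : Fin N → ℝ) :
    ∑ i, E.mulVec x i ^ 2 ≤ specNorm E ^ 2 * ∑ j, x j ^ 2 := by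
  have h := Matrix.l2_opNorm_mulVec E (WithLp.toLp 2 x)
  have h2 := pow_le_pow_left₀ (norm_nonneg _) h 2
  rw [mul_pow, EuclideanSpace.real_norm_sq_eq, EuclideanSpace.real_norm_sq_eq] at h2
  exact h2

theorem integrable_errorCov_entry {M N : ℕ} {ν : Measure (Matrix (Fin M) (Fin N) ℝ)}
    (hν : FiniteSecondMoment ν) (i j : Fin N) :
    Integrable (fun E : Matrix (Fin M) (Fin N) ℝ => (E.transpose * E) i j) ν := by
  have hmeas : ∀ k l, Measurable fun E : Matrix (Fin M) (Fin N) ℝ => E k l := fun k l =>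
    (measurable_pi_apply l).comp (measurable_pi_apply k)
  have hcol : ∀ (E : Matrix (Fin M) (Fin N) ℝ) l, ∑ k, E k l ^ 2 ≤ specNorm E ^ 2 := by
    intro E l
    simpa [Pi.single_apply] using sum_mulVec_sq_le E (Pi.single l 1)
  refine Integrable.mono' hν ?_ (ae_of_all _ fun E => ?_)
  · simp only [Matrix.mul_apply, Matrix.transpose_apply]
    exact (Finset.measurable_sum _ fun k _ => (hmeas k i).mul (hmeas k j)).aestronglyMeasurable
  · simp only [Matrix.mul_apply, Matrix.transpose_apply, Real.norm_eq_abs]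
    calc |∑ k, E k i * E k j| ≤ ∑ k, |E k i * E k j| := Finset.abs_sum_le_sum_abs _ _
      _ ≤ ∑ k, (E k i ^ 2 + E k j ^ 2) / 2 := by
        refine Finset.sum_le_sum fun k _ => ?_
        rw [abs_mul]
        nlinarith [sq_nonneg (|E k i| - |E k j|), sq_abs (E k i), sq_abs (E k j)]
      _ ≤ specNorm E ^ 2 := by
        rw [← Finset.sum_div, Finset.sum_add_distrib]
        linarith [hcol E i, hcol E j]

theorem dotProduct_errorCov_mulVec {M N : ℕ} {ν : Measure (Matrix (Fin M) (Fin N) ℝ)}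
    (hν : FiniteSecondMoment ν) (x : Fin N → ℝ) :
    x ⬝ᵥ (errorCov ν).mulVec x = ∫ E, ∑ i, E.mulVec x i ^ 2 ∂ν := by
  have h1 : ∀ E : Matrix (Fin M) (Fin N) ℝ,
      ∑ i, E.mulVec x i ^ 2 = ∑ i, x i * ∑ j, (E.transpose * E) i j * x j := by
    intro E
    have : x ⬝ᵥ (E.transpose * E).mulVec x = E.mulVec x ⬝ᵥ E.mulVec x := by
      rw [← Matrix.mulVec_mulVec, Matrix.dotProduct_mulVec, Matrix.vecMul_transpose]
    simp only [dotProduct, Matrix.mulVec, ← pow_two] at this ⊢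
    exact this.symm
  simp_rw [h1]
  rw [integral_finsetSum _ fun i _ => (integrable_finsetSum _ fun j _ =>
    (integrable_errorCov_entry hν i j).mul_const _).const_mul _]
  refine Finset.sum_congr rfl fun i _ => ?_
  rw [integral_const_mul, integral_finsetSum _ fun j _ =>
    (integrable_errorCov_entry hν i j).mul_const _]
  simp_rw [integral_mul_const]
  rfl

theorem errorCov_posSemidef {M N : ℕ} {ν : Measure (Matrix (Fin M) (Fin N) ℝ)}
    (hν : FiniteSecondMoment ν) : (errorCov ν).PosSemidef := by
  refine .of_dotProduct_mulVec_nonneg ?_ fun x => ?_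
  · ext i j
    simp [errorCov, Matrix.mul_apply, mul_comm]
  · rw [star_trivial, dotProduct_errorCov_mulVec hν]
    exact integral_nonneg fun E => Finset.sum_nonneg fun _ _ => sq_nonneg _

theorem penalty_le {M N : ℕ} {ν : Measure (Matrix (Fin M) (Fin N) ℝ)}
    (hν : FiniteSecondMoment ν) (x : Fin N → ℝ) :
    penalty (errorCov ν) x ≤ rmsNorm ν * √(∑ j, x j ^ 2) := by
  rw [penalty, rmsNorm, ← Real.sqrt_mul (integral_nonneg fun _ => sq_nonneg _),
    dotProduct_errorCov_mulVec hν, ← integral_mul_const]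
  refine Real.sqrt_le_sqrt (integral_mono_of_nonneg
    (ae_of_all _ fun E => Finset.sum_nonneg fun _ _ => sq_nonneg _) (Integrable.mul_const hν _)
    (ae_of_all _ fun E => sum_mulVec_sq_le E x))

open scoped MatrixOrder Matrix.Norms.L2Operator in
/-- For positive semidefinite `P = BᵀB` the penalty is the seminorm `x ↦ ‖Bx‖₂`. -/
theorem penalty_add_le {N : ℕ} {P : Matrix (Fin N) (Fin N) ℝ} (hP : P.PosSemidef)
    (x y : Fin N → ℝ) : penalty P (x + y) ≤ penalty P x + penalty P y := by
  obtain ⟨B, rfl⟩ := CStarAlgebra.nonneg_iff_eq_star_mul_self.mp hP.nonneg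
  have h : ∀ z, penalty (star B * B) z = ‖WithLp.toLp 2 (B.mulVec z)‖ := by
    intro z
    rw [penalty, ← Matrix.mulVec_mulVec, Matrix.dotProduct_mulVec, Matrix.star_eq_conjTranspose,
      Matrix.conjTranspose_eq_transpose_of_trivial, Matrix.vecMul_transpose,
      EuclideanSpace.norm_eq]
    simp [dotProduct, pow_two]
  rw [h, h, h, Matrix.mulVec_add, WithLp.toLp_add]
  exact norm_add_le _ _

/-- Moving away from a `K`-sparse `a` by `h` increases the `ℓ₁` norm by at least
`‖h‖₁ - 2 ∑_{j ∈ supp a} |hⱼ|`, and Cauchy–Schwarz bounds the sum over the support by `√K ‖h‖₂`. -/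
theorem ellOne_sub_le {N : ℕ} (a h : Fin N → ℝ) {K : ℕ} (hK : hammingNorm a ≤ K) :
    ellOne a + ellOne h ≤ ellOne (a + h) + 2 * √K * √(∑ j, h j ^ 2) := by
  classical
  set S : Finset (Fin N) := Finset.univ.filter fun j => a j ≠ 0 with hS
  have hcs : ∑ j ∈ S, |h j| ≤ √K * √(∑ j, h j ^ 2) := by
    rw [← Real.sqrt_mul (Nat.cast_nonneg _)]
    refine Real.le_sqrt_of_sq_le ?_
    calc (∑ j ∈ S, |h j|) ^ 2 ≤ S.card * ∑ j ∈ S, |h j| ^ 2 := sq_sum_le_card_mul_sum_sq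
      _ ≤ K * ∑ j, h j ^ 2 := by
        simp only [sq_abs]
        gcongr
        · exact hK
        · exact Finset.subset_univ _
  have hpt : ∀ j, |a j| + |h j| ≤ |a j + h j| + 2 * (if a j ≠ 0 then |h j| else 0) := by
    intro j
    split_ifs with hj
    · have := abs_sub_abs_le_abs_sub (a j) (-h j)
      rw [abs_neg, sub_neg_eq_add] at this
      linarith
    · simp [not_not.mp hj]
  have hsum := Finset.sum_le_sum fun j (_ : j ∈ Finset.univ) => hpt j
  rw [Finset.sum_add_distrib, Finset.sum_add_distrib, ← Finset.mul_sum,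
    ← Finset.sum_filter, ← hS] at hsum
  simp only [ellOne, Pi.add_apply]
  linarith

/-- The deterministic recovery criterion: it suffices that the kernel of `A` contains no nonzero
vector whose `ℓ₁` norm is at most `2√K + λ(𝔼‖E‖²)^{1/2}` times its `ℓ₂` norm. -/
theorem relaxationSolves_of_kernel {M N : ℕ} {A : Matrix (Fin M) (Fin N) ℝ}
    {ν : Measure (Matrix (Fin M) (Fin N) ℝ)} (hν : FiniteSecondMoment ν) {lam : ℝ}
    (hlam : 0 ≤ lam) {K : ℕ}
    (hA : ∀ h : Fin N → ℝ, h ≠ 0 → A.mulVec h = 0 →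
      (2 * √K + lam * rmsNorm ν) * √(∑ j, h j ^ 2) < ellOne h) :
    RelaxationSolves A (errorCov ν) lam K := by
  intro y α hα hK
  have hlt : ∀ θ ∈ feasible A y, θ ≠ α →
      ellOne α + lam * penalty (errorCov ν) α < ellOne θ + lam * penalty (errorCov ν) θ := by
    intro θ hθ hne
    have hker : A.mulVec (θ - α) = 0 := by
      rw [Matrix.mulVec_sub, hθ, hα.1, sub_self]
    have h1 := hA _ (sub_ne_zero.mpr hne) hker
    have h2 := ellOne_sub_le α (θ - α) hK
    rw [add_sub_cancel] at h2
    have h3 := penalty_add_le (errorCov_posSemidef hν) θ (α - θ)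
    have h4 := penalty_le hν (α - θ)
    have h5 : ∑ j, (α - θ) j ^ 2 = ∑ j, (θ - α) j ^ 2 :=
      Finset.sum_congr rfl fun j _ => by simp only [Pi.sub_apply]; ring
    rw [add_sub_cancel] at h3
    rw [h5] at h4
    nlinarith [mul_le_mul_of_nonneg_left (h3.trans (add_le_add_right h4 _)) hlam]
  ext β
  refine ⟨fun hβ => ?_, ?_⟩
  · by_contra hne
    exact absurd (hβ.2 hα.1) (not_le.mpr (hlt β hβ.1 hne))
  · rintro rfl
    refine ⟨hα.1, fun θ hθ => ?_⟩
    rcases eq_or_ne θ β with rfl | hne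
    · exact le_refl (ellOne θ + lam * penalty (errorCov ν) θ)
    · exact (hlt θ hθ hne).le

/-! ### Kernels of Gaussian matrices -/

theorem measure_mulVec_small_le {Ω : Type*} [MeasurableSpace Ω] {μ : Measure Ω} {M N : ℕ}
    {A : Ω → Matrix (Fin M) (Fin N) ℝ} (hA : IsStdGaussianMatrix A μ) {w : Fin N → ℝ}
    (hw : 0 < ∑ j, w j ^ 2) :
    μ.real {ω | ∑ i, (A ω).mulVec w i ^ 2 ≤ M / 16 * ∑ j, w j ^ 2} ≤ Real.exp (-M / 2) := by
  set r := √(∑ j, w j ^ 2) with hr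
  have hr2 : r ^ 2 = ∑ j, w j ^ 2 := Real.sq_sqrt hw.le
  have hr0 : 0 < r := Real.sqrt_pos.mpr hw
  have hunit : ∑ j, (r⁻¹ • w) j ^ 2 = 1 := by
    simp only [Pi.smul_apply, smul_eq_mul, mul_pow, ← Finset.mul_sum]
    rw [← hr2]
    field_simp
  obtain ⟨h1, h2⟩ := mulVec_gaussian hA hunit
  have h := measure_sum_sq_le_le h1 h2
  rw [Fintype.card_fin] at h
  convert h using 4 with ω
  simp only [Matrix.mulVec_smul, Pi.smul_apply, smul_eq_mul, mul_pow, ← Finset.mul_sum]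
  rw [← hr2, inv_pow, inv_mul_le_iff₀ (by positivity), mul_comm (r ^ 2)]

theorem measure_column_large_le {Ω : Type*} [MeasurableSpace Ω] {μ : Measure Ω} {M N : ℕ}
    {A : Ω → Matrix (Fin M) (Fin N) ℝ} (hA : IsStdGaussianMatrix A μ) (j : Fin N) :
    μ.real {ω | 8 * (M : ℝ) ≤ ∑ i, A ω i j ^ 2} ≤ Real.exp (-M) := by
  have h := measure_sum_sq_ge_le (fun i => hA.1 i j)
    (hA.2.precomp (g := fun i => (i, j)) (Prod.mk_left_injective j))
  rwa [Fintype.card_fin] at h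

/-- The matrix `A` violates the width bound at level `1/72`: its kernel contains a nonzero `h` with
`‖h‖₁ √(log N) ≤ √M ‖h‖₂ / 72`. -/
def HasFlatKernelVector {M N : ℕ} (A : Matrix (Fin M) (Fin N) ℝ) : Prop :=
  ∃ h : Fin N → ℝ, h ≠ 0 ∧ A.mulVec h = 0 ∧
    ellOne h ^ 2 * Real.log N ≤ (1 / 72) ^ 2 * M * ∑ j, h j ^ 2

theorem sum_sq_le_ellOne_sq {N : ℕ} (h : Fin N → ℝ) : ∑ j, h j ^ 2 ≤ ellOne h ^ 2 := by
  have := Finset.sum_sq_le_sq_sum_of_nonneg (s := Finset.univ) fun j _ => abs_nonneg (h j)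
  simp only [sq_abs] at this
  exact this

theorem sum_sq_pos {N : ℕ} {h : Fin N → ℝ} (hne : h ≠ 0) : 0 < ∑ j, h j ^ 2 := by
  obtain ⟨j, hj⟩ := Function.ne_iff.mp hne
  exact Finset.sum_pos' (fun _ _ => sq_nonneg _) ⟨j, Finset.mem_univ _, sq_pos_of_ne_zero hj⟩

/-- As `‖h‖₂ ≤ ‖h‖₁`, a flat kernel vector can only exist when `M` is large compared
with `log N`. -/
theorem HasFlatKernelVector.log_le {M N : ℕ} {A : Matrix (Fin M) (Fin N) ℝ}
    (hA : HasFlatKernelVector A) : Real.log N ≤ (1 / 72) ^ 2 * M := by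
  obtain ⟨h, hne, -, hb⟩ := hA
  refine le_of_mul_le_mul_right ?_ (sum_sq_pos hne)
  nlinarith [mul_le_mul_of_nonneg_left (sum_sq_le_ellOne_sq h) (Real.log_natCast_nonneg N)]

/-- For `N ≤ 1` one has `log N = 0`, so that every nonzero kernel vector is flat; but a nonzero
kernel vector forces the only column to vanish. -/
theorem measure_hasFlatKernelVector_le_of_le_one {Ω : Type*} [MeasurableSpace Ω] {μ : Measure Ω}
    {M N : ℕ} {A : Ω → Matrix (Fin M) (Fin N) ℝ} (hA : IsStdGaussianMatrix A μ) (hN : N ≤ 1) :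
    μ.real {ω | HasFlatKernelVector (A ω)} ≤ Real.exp (-M / 2) := by
  have := hA.2.isProbabilityMeasure
  interval_cases N
  · have : {ω | HasFlatKernelVector (A ω)} = ∅ := by
      ext ω
      simp only [Set.mem_ofPred_eq, Set.mem_empty_iff_false, iff_false]
      rintro ⟨h, hne, -⟩
      exact hne (Subsingleton.elim _ _)
    rw [this, measureReal_empty]
    positivity
  · refine le_trans (measureReal_mono ?_) (measure_mulVec_small_le hA (w := fun _ => 1) (by simp))
    rintro ω ⟨h, hne, hker, -⟩
    have h0 : h 0 ≠ 0 := fun h0 => hne (funext fun j => by rw [Subsingleton.elim j 0, h0]; rfl)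
    have hw : (fun _ : Fin 1 => (1 : ℝ)) = (h 0)⁻¹ • h := by
      ext j
      rw [Subsingleton.elim j 0]
      simp [h0]
    simp only [Set.mem_ofPred_eq]
    rw [hw, Matrix.mulVec_smul, hker]
    simp only [smul_zero, Pi.zero_apply, ne_eq, OfNat.ofNat_ne_zero, not_false_eq_true, zero_pow,
      Finset.sum_const_zero]
    positivity

/-- Union bound over the columns, which have to be controlled in norm, and over the `(2N)^m` words
of length `m` in the signed coordinate vectors. -/
theorem measure_hasFlatKernelVector_le_union {Ω : Type*} [MeasurableSpace Ω] {μ : Measure Ω}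
    {M N : ℕ} {A : Ω → Matrix (Fin M) (Fin N) ℝ} (hA : IsStdGaussianMatrix A μ) (hM : 0 < M)
    (hN : 2 ≤ N) {m : ℕ} (hm0 : 0 < m)
    (hm : 324 * ((1 / 72) ^ 2 * M / Real.log N) ≤ m) :
    μ.real {ω | HasFlatKernelVector (A ω)}
      ≤ N * Real.exp (-M) + (2 * N) ^ m * Real.exp (-M / 2) := by
  have := hA.2.isProbabilityMeasure
  have hlog : 0 < Real.log N := Real.log_pos (by exact_mod_cast hN)
  have hMR : (0 : ℝ) < M := by exact_mod_cast hM
  set S : (Fin m → Fin N × ℤˣ) → Set Ω := fun f => {ω | 0 < ∑ j, signedSum f j ^ 2 ∧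
    ∑ i, (A ω).mulVec (signedSum f) i ^ 2 ≤ M / 16 * ∑ j, signedSum f j ^ 2}
  have hS : ∀ f, μ.real (S f) ≤ Real.exp (-M / 2) := by
    intro f
    by_cases hf : 0 < ∑ j, signedSum f j ^ 2
    · exact (measureReal_mono fun ω hω => hω.2).trans (measure_mulVec_small_le hA hf)
    · simp only [S, hf, false_and, Set.ofPred_false, measureReal_empty]
      positivity
  have hsub : {ω | HasFlatKernelVector (A ω)}
      ⊆ (⋃ j, {ω | 8 * (M : ℝ) ≤ ∑ i, A ω i j ^ 2}) ∪ ⋃ f, S f := by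
    rintro ω ⟨h, hne, hker, hb⟩
    by_cases hcol : ∃ j, 8 * (M : ℝ) ≤ ∑ i, A ω i j ^ 2
    · exact Or.inl (Set.mem_iUnion.mpr hcol)
    · push Not at hcol
      obtain ⟨f, hf0, hf⟩ := exists_signedSum_mulVec_small (A ω) (D := 8 * M) (by positivity)
        (fun j => (hcol j).le) h hne hker
        (by rw [div_mul_eq_mul_div, le_div_iff₀ hlog]; exact hb) hm0 hm
      refine Or.inr (Set.mem_iUnion.mpr ⟨f, hf0, hf.trans_eq ?_⟩)
      ring
  refine (measureReal_mono hsub).trans ((measureReal_union_le _ _).trans (add_le_add ?_ ?_))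
  · refine (measureReal_iUnion_fintype_le _).trans
      ((Finset.sum_le_sum fun j _ => measure_column_large_le hA j).trans_eq ?_)
    simp
  · refine (measureReal_iUnion_fintype_le _).trans
      ((Finset.sum_le_sum fun f _ => hS f).trans_eq ?_)
    simp [mul_comm]

/-- The width bound for Gaussian kernels. The word length `m = ⌈324 s⌉`, with
`s = M / (72² log N) ≥ 1`, keeps `m log (2N) ≤ M / 4`, so that the union bound costs only half of
the exponent `M / 2`; the remaining factor `2` is absorbed because `log 2 ≤ log N ≤ M / 72²`. -/
theorem measure_hasFlatKernelVector_le {Ω : Type*} [MeasurableSpace Ω] {μ : Measure Ω}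
    {M N : ℕ} {A : Ω → Matrix (Fin M) (Fin N) ℝ} (hA : IsStdGaussianMatrix A μ) :
    μ.real {ω | HasFlatKernelVector (A ω)} ≤ Real.exp (-M / 8) := by
  have := hA.2.isProbabilityMeasure
  rcases Nat.eq_zero_or_pos M with rfl | hM
  · simp
  have hMR : (0 : ℝ) < M := by exact_mod_cast hM
  rcases Nat.lt_or_ge 1 N with hN | hN
  swap
  · exact (measure_hasFlatKernelVector_le_of_le_one hA hN).trans
      (Real.exp_le_exp.mpr (by linarith))
  -- If `M` is small compared with `log N`, then the event is empty.
  by_cases hlogM : Real.log N ≤ (1 / 72) ^ 2 * M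
  swap
  · have : {ω | HasFlatKernelVector (A ω)} = ∅ :=
      Set.eq_empty_of_forall_notMem fun ω hω => hlogM hω.log_le
    rw [this, measureReal_empty]
    positivity
  have hNR : (2 : ℝ) ≤ N := by exact_mod_cast hN
  have hlog : 0 < Real.log N := Real.log_pos (by linarith)
  set s : ℝ := (1 / 72) ^ 2 * M / Real.log N with hs
  have hs1 : 1 ≤ s := (one_le_div hlog).mpr hlogM
  have hslog : s * Real.log N = (1 / 72) ^ 2 * M := div_mul_cancel₀ _ hlog.ne'
  have hmlt : (⌈324 * s⌉₊ : ℝ) < 324 * s + 1 := Nat.ceil_lt_add_one (by linarith)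
  have hlog2 : Real.log 2 ≤ Real.log N := Real.log_le_log two_pos hNR
  refine (measure_hasFlatKernelVector_le_union hA hM hN (m := ⌈324 * s⌉₊)
    (Nat.ceil_pos.mpr (by linarith)) (Nat.le_ceil _)).trans ?_
  have hexp1 : N * Real.exp (-M) ≤ Real.exp (-M / 4) := by
    rw [← Real.exp_log (show (0 : ℝ) < N by linarith), ← Real.exp_add]
    exact Real.exp_le_exp.mpr (by linarith)
  have hexp2 : (2 * N : ℝ) ^ ⌈324 * s⌉₊ * Real.exp (-M / 2) ≤ Real.exp (-M / 4) := by
    rw [← Real.exp_log (show (0 : ℝ) < 2 * N by linarith), ← Real.exp_nat_mul, ← Real.exp_add,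
      Real.log_mul two_ne_zero (by linarith)]
    refine Real.exp_le_exp.mpr ?_
    have h1 : (⌈324 * s⌉₊ : ℝ) * (Real.log 2 + Real.log N) ≤ 648 * s * (2 * Real.log N) :=
      mul_le_mul (by linarith) (by linarith)
        (add_nonneg (Real.log_nonneg one_le_two) hlog.le) (by linarith)
    linarith
  have hexp3 : 2 * Real.exp (-M / 4) ≤ Real.exp (-M / 8) := by
    nth_rewrite 1 [← Real.exp_log two_pos]
    rw [← Real.exp_add]
    exact Real.exp_le_exp.mpr (by linarith)
  linarith

theorem relaxationSolves_of_not_hasFlatKernelVector {M N : ℕ} {A : Matrix (Fin M) (Fin N) ℝ}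
    (hA : ¬ HasFlatKernelVector A) {ν : Measure (Matrix (Fin M) (Fin N) ℝ)}
    (hν : FiniteSecondMoment ν) {lam : ℝ} (hlam : 0 ≤ lam) {K : ℕ}
    (hM : (2 * √K + lam * rmsNorm ν) ^ 2 / (1 / 72) ^ 2 * Real.log N ≤ M) :
    RelaxationSolves A (errorCov ν) lam K := by
  refine relaxationSolves_of_kernel hν hlam fun h hne hker => ?_
  simp only [HasFlatKernelVector, not_exists, not_and, not_le] at hA
  have h1 := hA h hne hker
  set T := 2 * √(K : ℝ) + lam * rmsNorm ν with hT
  have hq := sum_sq_pos hne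
  have hell : 0 ≤ ellOne h := Finset.sum_nonneg fun _ _ => abs_nonneg _
  have h2 : T ^ 2 * Real.log N ≤ (1 / 72) ^ 2 * M := by
    rw [div_mul_eq_mul_div, div_le_iff₀ (by norm_num)] at hM
    linarith
  have h3 : T ^ 2 * (∑ j, h j ^ 2) < ellOne h ^ 2 := by
    refine lt_of_mul_lt_mul_right ?_ (Real.log_natCast_nonneg N)
    nlinarith [mul_le_mul_of_nonneg_right h2 hq.le]
  refine lt_of_pow_lt_pow_left₀ 2 hell ?_
  rwa [mul_pow, Real.sq_sqrt hq.le]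

theorem theorem1 :
    ∃ C₁ : ℝ, 0 < C₁ ∧ ∃ c : ℝ, 0 < c ∧
      ∀ (M N : ℕ) (Ω : Type*) [MeasurableSpace Ω] (μ : Measure Ω) [IsProbabilityMeasure μ]
        (Abar : Ω → Matrix (Fin M) (Fin N) ℝ), IsStdGaussianMatrix Abar μ →
        μ {ω | ¬ ∀ (ν : Measure (Matrix (Fin M) (Fin N) ℝ)) (K : ℕ) (lam : ℝ),
            IsProbabilityMeasure ν → FiniteSecondMoment ν → 0 ≤ lam →
            ((2 * Real.sqrt K + lam * rmsNorm ν) ^ 2 / C₁ ^ 2 * Real.log N ≤ M →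
              RelaxationSolves (Abar ω) (errorCov ν) lam K) ∧
            (∀ κ : ℝ, 1 ≤ κ → rmsNorm ν ≤ κ * meanNorm ν →
              (2 * Real.sqrt K + lam * meanNorm ν) ^ 2 / (C₁ / κ) ^ 2 * Real.log N ≤ M →
              RelaxationSolves (Abar ω) (errorCov ν) lam K)}
          ≤ ENNReal.ofReal (Real.exp (-(c * M))) := by
  refine ⟨1 / 72, by norm_num, 1 / 8, by norm_num, fun M N Ω _ μ _ A hA => ?_⟩
  calc _ ≤ μ {ω | HasFlatKernelVector (A ω)} := by
        refine measure_mono fun ω hω => ?_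
        by_contra hflat
        refine hω fun ν K lam _ hν hlam =>
          ⟨relaxationSolves_of_not_hasFlatKernelVector hflat hν hlam, fun κ hκ hrms hM =>
            relaxationSolves_of_not_hasFlatKernelVector hflat hν hlam (le_trans ?_ hM)⟩
        have hrms0 : 0 ≤ rmsNorm ν := Real.sqrt_nonneg _
        have h1 : 2 * √(K : ℝ) + lam * rmsNorm ν ≤ κ * (2 * √K + lam * meanNorm ν) := by
          nlinarith [mul_le_mul_of_nonneg_left hrms hlam,
            mul_nonneg (sub_nonneg.mpr hκ) (Real.sqrt_nonneg (K : ℝ))]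
        refine mul_le_mul_of_nonneg_right ?_ (Real.log_natCast_nonneg N)
        calc (2 * √(K : ℝ) + lam * rmsNorm ν) ^ 2 / (1 / 72) ^ 2
            ≤ (κ * (2 * √K + lam * meanNorm ν)) ^ 2 / (1 / 72) ^ 2 := by gcongr
          _ = (2 * √K + lam * meanNorm ν) ^ 2 / (1 / 72 / κ) ^ 2 := by
            field_simp
    _ = ENNReal.ofReal (μ.real {ω | HasFlatKernelVector (A ω)}) := by
        rw [ofReal_measureReal]
    _ ≤ _ := by
        refine ENNReal.ofReal_le_ofReal ((measure_hasFlatKernelVector_le hA).trans_eq ?_)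
        ring_nf
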